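/- \textbf{Conventions.} All groups are finite, $p$ is a prime and $P$ is a $p$-group. A \emph{fusion system} $\mathcal F$ on $P$ is a category whose objects are the subgroups of $P$, whose morphisms are injective group homomorphisms, which contains all homomorphisms between subgroups of $P$ that are induced by conjugation by elements of $P$, and in which every morphism is the composite of an isomorphism of the category onto its image and an inclusion. A subgroup $R\le P$ is an $\mathcal F$-conjugate of $Q\le P$ (written $R\in Q^{\mathcal F}$) if $R=\phi(Q)$ for some $\phi\in\mathrm{Hom}_{\mathcal F}(Q,R)$. $Q$ is \emph{fully normalized} if $|N_P(Q)|\ge |N_P(R)|$ for all $R\in Q^{\mathcal F}$, and \emph{strongly $\mathcal F$-closed} if $\phi(x)\in Q$ for all $x\in Q$ and $\phi\in \mathrm{Hom}_{\mathcal F}(\langle x\rangle,P)$. Write $c_x$ for conjugation by $x$, $\mathrm{Aut}_{\mathcal F}(Q)=\mathrm{Hom}_{\mathcal F}(Q,Q)$, and $\mathrm{Aut}_P(Q)$ for the group of automorphisms of $Q$ induced by conjugation by elements of $N_P(Q)$. For a morphism $\phi$ of $\mathcal F$ defined on $Q$, let $$N_\phi=\{x\in N_P(Q)\mid \exists\,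 y\in N_P(\phi(Q)):\ \phi\, c_x\,\phi^{-1}=c_y \text{ on } \phi(Q)\},$$ a subgroup of $P$ containing $Q$. $\mathcal F$ is \emph{saturated} if $\mathrm{Aut}_P(P)$ is a Sylow $p$-subgroup of $\mathrm{Aut}_{\mathcal F}(P)$ and every $\phi\in\mathrm{Hom}_{\mathcal F}(Q,P)$, $Q\le P$, with $\phi(Q)$ fully normalized extends to a morphism in $\mathrm{Hom}_{\mathcal F}(N_\phi,P)$. A fusion system $\mathcal E$ on $P$ is \emph{semisaturated} if there are a $p$-group $S\ge P$ and a saturated fusion system $\mathcal F$ on $S$ such that $P$ is strongly $\mathcal F$-closed and $\mathrm{Hom}_{\mathcal E}(Q,R)=\mathrm{Hom}_{\mathcal F}(Q,R)$ for all $Q,R\le P$. Let $\mathcal E$ be a fusion system on $P$. A subgroup $Q\le P$ is \emph{receptive} if every $\mathcal E$-isomorphism $\phi:R\to Q$ extends to a morphism in $\mathrm{Hom}_{\mathcal E}(N_\phi,P)$. A proper subgroup $R<P$ is \emph{reproductive}, written $R\in\mathcal E^r$, if it is receptive and for each $Q\in R^{\mathcal E}$ there is $\psi\in\mathrm{Hom}_{\mathcal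 E}(Q,R)$ with $N_\psi>Q$. A subgroup $Q$ is \emph{$\mathcal E$-essential} if $Q\in\mathcal E^r$ and $\langle \phi\in\mathrm{Aut}_{\mathcal E}(Q)\mid N_\phi>Q\rangle$ is a proper subgroup of $\mathrm{Aut}_{\mathcal E}(Q)$. An \emph{$\mathcal E$-conjugacy representative} of $\mathcal E^r$ is a subset $\mathfrak U\subseteq\mathcal E^r$ such that each member of $\mathcal E^r$ has exactly one $\mathcal E$-conjugate in $\mathfrak U$. An \emph{essential collection} is a set of the form $\mathfrak E=\{Q\in\mathfrak U\mid Q \text{ is } \mathcal E\text{-essential}\}$ for some $\mathcal E$-conjugacy representative $\mathfrak U$ of $\mathcal E^r$; it is a \emph{main essential collection} if all its members are fully normalized in $\mathcal E$. \textbf{Theorem.} Let $\mathcal E$ be a semisaturated fusion system on a $p$-group $P$. Then a (possibly empty) main essential collection exists. Moreover, for any main essential collection $\mathfrak E$, $$\mathcal E=\langle \mathrm{Aut}_{\mathcal E}(Q)\mid Q\in\mathfrak E \text{ or } Q=P\rangle,$$ where the right-hand side is the smallest fusion system on $P$ containing all these automorphism groups. -/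

import Mathlib

universe u

/-- A fusion system on a group `P` (used for finite `p`-groups): a category whose objects are the
subgroups of `P`, whose morphisms are injective group homomorphisms, which contains every
homomorphism induced by conjugation with an element of `P`, and in which every morphism `φ : Q → R`
is an isomorphism (in the category) onto its image followed by an inclusion. -/
@[ext]
structure FusionSystem (P : Type u) [Group P] where
  /-- The set of morphisms from `Q` to `R`. -/
  Hom : (Q R : Subgroup P) → Set (Q →* R)
  injective : ∀ {Q R : Subgroup P} {φ : Q →* R}, φ ∈ Hom Q R → Function.Injective φ
  conj_mem : ∀ {Q R : Subgroup P} (g : P) (φ : Q →* R),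
    (∀ x : Q, (φ x : P) = g * x * g⁻¹) → φ ∈ Hom Q R
  comp_mem : ∀ {Q R T : Subgroup P} {φ : Q →* R} {ψ : R →* T},
    φ ∈ Hom Q R → ψ ∈ Hom R T → ψ.comp φ ∈ Hom Q T
  /-- If `φ ∈ Hom Q R` and `e : Q ≃* T` is `φ` regarded as an isomorphism onto its image `T`,
  then `e` and its inverse are morphisms. -/
  iso_mem : ∀ {Q R T : Subgroup P} {φ : Q →* R} (e : Q ≃* T), φ ∈ Hom Q R →
    (∀ x : Q, (e x : P) = φ x) →
    e.toMonoidHom ∈ Hom Q T ∧ e.symm.toMonoidHom ∈ Hom T Q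

namespace FusionSystem

variable {P : Type u} [Group P]

theorem id_mem (F : FusionSystem P) (Q : Subgroup P) : MonoidHom.id Q ∈ F.Hom Q Q :=
  F.conj_mem 1 _ (by simp)

/-- `Aut_F(Q)`, as a subgroup of the automorphism group of `Q`. -/
def Aut (F : FusionSystem P) (Q : Subgroup P) : Subgroup (MulAut Q) where
  carrier := {α | α.toMonoidHom ∈ F.Hom Q Q}
  one_mem' := F.id_mem Q
  mul_mem' := fun {_ _} ha hb => F.comp_mem hb ha
  inv_mem' := fun {a} ha => (F.iso_mem a ha (fun _ => rfl)).2

/-- `Aut_P(Q)`, the automorphisms of `Q` induced by conjugation with elements of `N_P(Q)`. -/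
def innerAut (Q : Subgroup P) : Subgroup (MulAut Q) :=
  Q.normalizerMonoidHom.range

/-- `R` is an `F`-conjugate of `Q`, i.e. `R` is the image of a morphism defined on `Q`. -/
def IsConj (F : FusionSystem P) (Q R : Subgroup P) : Prop :=
  ∃ φ ∈ F.Hom Q R, Function.Surjective φ

/-- `Q` is fully normalized: `|N_P(R)| ≤ |N_P(Q)|` for all `F`-conjugates `R` of `Q`. -/
def IsFullyNormalized (F : FusionSystem P) (Q : Subgroup P) : Prop :=
  ∀ R : Subgroup P, F.IsConj Q R →
    Nat.card (Subgroup.normalizer (R : Set P)) ≤ Nat.card (Subgroup.normalizer (Q : Set P))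

/-- `Q` is strongly `F`-closed: the image of any `x ∈ Q` under any morphism `⟨x⟩ → P` is in `Q`. -/
def IsStronglyClosed (F : FusionSystem P) (Q : Subgroup P) : Prop :=
  ∀ x ∈ Q, ∀ φ ∈ F.Hom (Subgroup.zpowers x) ⊤,
    (φ ⟨x, Subgroup.mem_zpowers x⟩ : P) ∈ Q

/-- The image `φ(Q)` as a subgroup of `P`. -/
def image {Q R : Subgroup P} (φ : Q →* R) : Subgroup P :=
  φ.range.map R.subtype

/-- `N_φ`: the elements `x ∈ N_P(Q)` for which there is `y ∈ N_P(φ(Q))` such that `φ` carries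
conjugation by `x` on `Q` to conjugation by `y` on `φ(Q)`. In the defining condition `v` stands for
the element `x u x⁻¹` of `Q`. -/
def extender {Q R : Subgroup P} (φ : Q →* R) : Subgroup P where
  carrier := {x | x ∈ Subgroup.normalizer (Q : Set P) ∧
    ∃ y ∈ Subgroup.normalizer (image φ : Set P),
      ∀ u v : Q, (v : P) = x * u * x⁻¹ → (φ v : P) = y * φ u * y⁻¹}
  one_mem' := by
    refine ⟨one_mem _, 1, one_mem _, fun u v h => ?_⟩
    have : v = u := Subtype.ext (by simpa using h)
    simp [this]
  mul_mem' := by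
    rintro a b ⟨ha, y, hy, hay⟩ ⟨hb, z, hz, hbz⟩
    refine ⟨mul_mem ha hb, y * z, mul_mem hy hz, fun u v h => ?_⟩
    have hw : b * (u : P) * b⁻¹ ∈ Q := (Subgroup.mem_normalizer_iff.mp hb u).mp u.2
    have h1 := hbz u ⟨_, hw⟩ rfl
    have h2 := hay ⟨_, hw⟩ v (by rw [h]; group)
    rw [h2, h1]; group
  inv_mem' := by
    rintro a ⟨ha, y, hy, hay⟩
    refine ⟨inv_mem ha, y⁻¹, inv_mem hy, fun u v h => ?_⟩
    have h1 := hay v u (by rw [h]; group)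
    rw [h1]; group

/-- `φ : Q → R` extends to a morphism `N_φ → P` of `F`. -/
def Extends (F : FusionSystem P) {Q R : Subgroup P} (φ : Q →* R) : Prop :=
  ∃ ψ ∈ F.Hom (extender φ) ⊤, ∀ (u : Q) (n : extender φ), (n : P) = u → (ψ n : P) = φ u

/-- Every `F`-isomorphism `φ : R → Q` extends to a morphism `N_φ → P` of `F`. -/
def IsReceptive (F : FusionSystem P) (Q : Subgroup P) : Prop :=
  ∀ (R : Subgroup P), ∀ φ ∈ F.Hom R Q, Function.Surjective φ → F.Extends φ

/-- A fusion system on a `p`-group `P` is saturated if `Aut_P(P)` is a Sylow `p`-subgroup of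
`Aut_F(P)` and every morphism `φ : Q → P` with fully normalized image extends to `N_φ`. -/
structure IsSaturated (p : ℕ) (F : FusionSystem P) : Prop where
  sylow : ∃ T : Sylow p (F.Aut ⊤), (T : Subgroup (F.Aut ⊤)) = (innerAut ⊤).subgroupOf (F.Aut ⊤)
  extend : ∀ (Q : Subgroup P), ∀ φ ∈ F.Hom Q ⊤, F.IsFullyNormalized (image φ) → F.Extends φ

/-- For an embedding `ι : P → S`, the homomorphism `ι(Q) → ι(R)` corresponding to `φ : Q → R`. -/
noncomputable def transport {S : Type u} [Group S] (ι : P →* S) (hι : Function.Injective ι)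
    {Q R : Subgroup P} (φ : Q →* R) : Q.map ι →* R.map ι :=
  ((R.equivMapOfInjective ι hι).toMonoidHom.comp φ).comp
    (Q.equivMapOfInjective ι hι).symm.toMonoidHom

/-- `E` is semisaturated: there are a finite `p`-group `S` containing `P` (via an embedding `ι`) and
a saturated fusion system `F` on `S` such that `P` is strongly `F`-closed and `E` is the restriction
of `F` to the subgroups of `P`, i.e. `Hom_E(Q, R) = Hom_F(Q, R)` for all `Q, R ≤ P`. -/
def IsSemisaturated (p : ℕ) (E : FusionSystem P) : Prop :=
  ∃ (S : Type u) (_ : Group S) (_ : Finite S) (_ : IsPGroup p S)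
    (ι : P →* S) (hι : Function.Injective ι) (F : FusionSystem S),
    F.IsSaturated p ∧ F.IsStronglyClosed ι.range ∧
      ∀ (Q R : Subgroup P) (φ : Q →* R),
        φ ∈ E.Hom Q R ↔ transport ι hι φ ∈ F.Hom (Q.map ι) (R.map ι)

/-- `R` is reproductive (`R ∈ F^r`): `R` is a proper receptive subgroup of `P` such that for each
`F`-conjugate `Q` of `R` there is `ψ ∈ Hom_F(Q, R)` with `N_ψ > Q`. -/
structure IsReproductive (F : FusionSystem P) (R : Subgroup P) : Prop where
  proper : R < ⊤
  receptive : F.IsReceptive R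
  exists_lt : ∀ Q : Subgroup P, F.IsConj R Q → ∃ ψ ∈ F.Hom Q R, Q < extender ψ

/-- `H_Q`, the subgroup generated by the `φ ∈ Aut_F(Q)` with `N_φ > Q`. -/
def essentialKernel (F : FusionSystem P) (Q : Subgroup P) : Subgroup (MulAut Q) :=
  Subgroup.closure {φ | φ ∈ F.Aut Q ∧ Q < extender φ.toMonoidHom}

/-- `Q` is `F`-essential: `Q` is reproductive and `H_Q` is proper in `Aut_F(Q)`. -/
structure IsEssential (F : FusionSystem P) (Q : Subgroup P) : Prop where
  reproductive : F.IsReproductive Q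
  kernel_lt : F.essentialKernel Q < F.Aut Q

/-- `U ⊆ V` is an `F`-conjugacy representative of the collection `V`: each member of `V` has
exactly one `F`-conjugate in `U`. -/
def IsConjRepresentative (F : FusionSystem P) (V U : Set (Subgroup P)) : Prop :=
  U ⊆ V ∧ ∀ Q ∈ V, ∃! R, R ∈ U ∧ F.IsConj Q R

/-- An essential collection: the essential members of an `F`-conjugacy representative of `F^r`. -/
def IsEssentialCollection (F : FusionSystem P) (C : Set (Subgroup P)) : Prop :=
  ∃ U : Set (Subgroup P), F.IsConjRepresentative {R | F.IsReproductive R} U ∧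
    C = {Q | Q ∈ U ∧ F.IsEssential Q}

/-- A main essential collection: an essential collection of fully normalized subgroups. -/
def IsMainEssentialCollection (F : FusionSystem P) (C : Set (Subgroup P)) : Prop :=
  F.IsEssentialCollection C ∧ ∀ Q ∈ C, F.IsFullyNormalized Q

/-- `⟨Aut_F(Q) | Q ∈ C⟩`: the smallest fusion system on `P` containing `Aut_F(Q)` for all `Q ∈ C`
(the intersection of all such fusion systems). -/
def autGenerated (F : FusionSystem P) (C : Set (Subgroup P)) : FusionSystem P where
  Hom Q R := {φ | ∀ D : FusionSystem P, (∀ T ∈ C, F.Aut T ≤ D.Aut T) → φ ∈ D.Hom Q R}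
  injective h := F.injective (h F fun _ _ => le_rfl)
  conj_mem g φ h := fun D _ => D.conj_mem g φ h
  comp_mem h₁ h₂ := fun D hD => D.comp_mem (h₁ D hD) (h₂ D hD)
  iso_mem e h he := ⟨fun D hD => (D.iso_mem e (h D hD) he).1,
    fun D hD => (D.iso_mem e (h D hD) he).2⟩

end FusionSystem

/-! The proof is Alperin's argument run on reproductive subgroups, and it rests on two facts.

Generation (`IsConjRepresentative.hom_subset`): suppose every proper subgroup has a reproductive
conjugate. By induction from large subgroups to small ones, a morphism on `Q` factors through
isomorphisms onto the representative `T` of the class of `Q`. Each conjugate of `T` has some `ψ`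
onto `T` that extends to a strictly larger subgroup, hence is known by induction, and any other
isomorphism onto `T` differs from `ψ` by an element of `Aut(T)`. Either `T` is essential, or
`Aut(T)` is generated by automorphisms that extend.

Existence (`IsSemisaturated.exists_reproductive`): let `F` on `S` realize `E`. The class of a proper
`Q` contains an `R` fully normalized in `F`; strong closure keeps `R` inside `P`. Since `Aut_S(R)`
is Sylow in `Aut_F(R)` (`IsSaturated.exists_sylow`), each conjugate of `R` has an isomorphism onto
`R` that extends to its whole normalizer. Restricted to `P`, these extensions make `R` both
reproductive and fully normalized in `E`. -/

namespace FusionSystem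

/-! ### Conjugacy, images and extenders in a fusion system. -/

section Basic

variable {P : Type u} [Group P] (F : FusionSystem P)

/-- Membership depends only on the values in `P`: the restriction is a map onto its image followed
by an inclusion. Domains may thus shrink and codomains change freely. -/
theorem mem_of_coe_eq {Q R Q' R' : Subgroup P} {φ : Q →* R} (hφ : φ ∈ F.Hom Q R) (hle : Q' ≤ Q)
    (ψ : Q' →* R') (h : ∀ x : Q', (ψ x : P) = φ (Subgroup.inclusion hle x)) :
    ψ ∈ F.Hom Q' R' := by
  have h1 : φ.comp (Subgroup.inclusion hle) ∈ F.Hom Q' R :=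
    F.comp_mem (F.conj_mem 1 _ (by simp)) hφ
  have hinj : Function.Injective (R'.subtype.comp ψ) := fun x y hxy => by
    apply F.injective h1
    apply Subtype.ext
    simpa [h] using hxy
  have h2 := (F.iso_mem (MonoidHom.ofInjective hinj) h1 (fun x => h x)).1
  have hT : (R'.subtype.comp ψ).range ≤ R' := by
    rintro _ ⟨x, rfl⟩
    exact (ψ x).2
  have h3 : Subgroup.inclusion hT ∈ F.Hom _ R' := F.conj_mem 1 _ (by simp)
  have h4 : ψ = (Subgroup.inclusion hT).comp (MonoidHom.ofInjective hinj).toMonoidHom := by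
    ext x
    rfl
  rw [h4]
  exact F.comp_mem h2 h3

theorem mem_of_coe_eq' {Q R R' : Subgroup P} {φ : Q →* R} (hφ : φ ∈ F.Hom Q R)
    (ψ : Q →* R') (h : ∀ x : Q, (ψ x : P) = φ x) : ψ ∈ F.Hom Q R' :=
  F.mem_of_coe_eq hφ le_rfl ψ h

theorem symm_mem {Q R : Subgroup P} (e : Q ≃* R) (he : e.toMonoidHom ∈ F.Hom Q R) :
    e.symm.toMonoidHom ∈ F.Hom R Q :=
  (F.iso_mem e he fun _ => rfl).2

theorem isConj_iff {Q R : Subgroup P} :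
    F.IsConj Q R ↔ ∃ e : Q ≃* R, e.toMonoidHom ∈ F.Hom Q R := by
  constructor
  · rintro ⟨φ, hφ, hs⟩
    exact ⟨MulEquiv.ofBijective φ ⟨F.injective hφ, hs⟩, hφ⟩
  · rintro ⟨e, he⟩
    exact ⟨_, he, e.surjective⟩

variable {F}

theorem IsConj.refl (Q : Subgroup P) : F.IsConj Q Q :=
  ⟨_, F.id_mem Q, Function.surjective_id⟩

theorem IsConj.symm {Q R : Subgroup P} (h : F.IsConj Q R) : F.IsConj R Q := by
  rw [isConj_iff] at h ⊢
  obtain ⟨e, he⟩ := h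
  exact ⟨e.symm, F.symm_mem e he⟩

theorem IsConj.trans {Q R T : Subgroup P} (h : F.IsConj Q R) (h' : F.IsConj R T) :
    F.IsConj Q T := by
  obtain ⟨φ, hφ, hs⟩ := h
  obtain ⟨ψ, hψ, ht⟩ := h'
  exact ⟨_, F.comp_mem hφ hψ, ht.comp hs⟩

theorem IsConj.card_eq {Q R : Subgroup P} (h : F.IsConj Q R) : Nat.card Q = Nat.card R := by
  obtain ⟨e, -⟩ := (F.isConj_iff).1 h
  exact Nat.card_congr e.toEquiv

theorem IsConj.surjective [Finite P] {Q R : Subgroup P} (h : F.IsConj Q R) {φ : Q →* R}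
    (hφ : φ ∈ F.Hom Q R) : Function.Surjective φ :=
  ((Nat.bijective_iff_injective_and_card φ).2 ⟨F.injective hφ, h.card_eq⟩).2

theorem mem_image {Q R : Subgroup P} {φ : Q →* R} {x : P} :
    x ∈ image φ ↔ ∃ u, (φ u : P) = x := by
  constructor
  · rintro ⟨_, ⟨u, rfl⟩, rfl⟩
    exact ⟨u, rfl⟩
  · rintro ⟨u, rfl⟩
    exact ⟨φ u, ⟨u, rfl⟩, rfl⟩

variable (F) in
theorem exists_equiv_image {Q R : Subgroup P} {φ : Q →* R} (hφ : φ ∈ F.Hom Q R) :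
    ∃ e : Q ≃* image φ, e.toMonoidHom ∈ F.Hom Q (image φ) ∧ ∀ x, (e x : P) = φ x := by
  let f : Q →* image φ :=
    (R.subtype.comp φ).codRestrict (image φ) fun x => mem_image.2 ⟨x, rfl⟩
  have hf : f ∈ F.Hom Q (image φ) := F.mem_of_coe_eq' hφ _ fun _ => rfl
  have hs : Function.Surjective f := by
    rintro ⟨x, hx⟩
    obtain ⟨u, hu⟩ := mem_image.1 hx
    exact ⟨u, Subtype.ext hu⟩
  exact ⟨MulEquiv.ofBijective f ⟨F.injective hf, hs⟩, hf, fun _ => rfl⟩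

theorem isConj_image {Q R : Subgroup P} {φ : Q →* R} (hφ : φ ∈ F.Hom Q R) :
    F.IsConj Q (image φ) := by
  obtain ⟨e, he, -⟩ := F.exists_equiv_image hφ
  exact F.isConj_iff.2 ⟨e, he⟩

theorem IsConj.top_iff [Finite P] {Q R : Subgroup P} (h : F.IsConj Q R) : Q = ⊤ ↔ R = ⊤ := by
  rw [← Subgroup.card_eq_iff_eq_top, ← Subgroup.card_eq_iff_eq_top, h.card_eq]

theorem image_congr {Q R R' : Subgroup P} {φ : Q →* R} {ψ : Q →* R'}
    (h : ∀ x, (φ x : P) = ψ x) : image φ = image ψ := by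
  ext x
  simp [mem_image, h]

theorem image_eq_of_surjective {Q R : Subgroup P} {φ : Q →* R} (h : Function.Surjective φ) :
    image φ = R := by
  ext x
  rw [mem_image]
  refine ⟨fun ⟨u, hu⟩ => hu ▸ (φ u).2, fun hx => ?_⟩
  obtain ⟨u, hu⟩ := h ⟨x, hx⟩
  exact ⟨u, congrArg Subtype.val hu⟩

theorem extender_congr {Q R R' : Subgroup P} {φ : Q →* R} {ψ : Q →* R'}
    (h : ∀ x, (φ x : P) = ψ x) : extender φ = extender ψ := by
  ext x
  change (_ ∧ ∃ y ∈ Subgroup.normalizer (image φ : Set P), _) ↔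
    (_ ∧ ∃ y ∈ Subgroup.normalizer (image ψ : Set P), _)
  simp only [h, image_congr h]

theorem Extends.congr {Q R R' : Subgroup P} {φ : Q →* R} {ψ : Q →* R'}
    (h : ∀ x, (φ x : P) = ψ x) (hψ : F.Extends ψ) : F.Extends φ := by
  unfold Extends at hψ ⊢
  rw [← extender_congr h] at hψ
  obtain ⟨χ, hχ, hx⟩ := hψ
  exact ⟨χ, hχ, fun u n hn => (hx u n hn).trans (h u).symm⟩

theorem mem_innerAut {Q : Subgroup P} {α : MulAut Q} :
    α ∈ innerAut Q ↔
      ∃ g ∈ Subgroup.normalizer (Q : Set P), ∀ x, (α x : P) = g * x * g⁻¹ := by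
  constructor
  · rintro ⟨g, rfl⟩
    exact ⟨g, g.2, fun x => rfl⟩
  · rintro ⟨g, hg, h⟩
    exact ⟨⟨g, hg⟩, MulEquiv.ext fun x => Subtype.ext (h x).symm⟩

theorem innerAut_le_aut (Q : Subgroup P) : innerAut Q ≤ F.Aut Q := by
  intro α hα
  obtain ⟨g, -, h⟩ := mem_innerAut.1 hα
  exact F.conj_mem g _ h

variable (F) in
theorem exists_isFullyNormalized [Finite P] (Q : Subgroup P) :
    ∃ R, F.IsConj Q R ∧ F.IsFullyNormalized R := by
  have : Nonempty {R // F.IsConj Q R} := ⟨⟨Q, .refl Q⟩⟩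
  obtain ⟨⟨R, hR⟩, h⟩ := Finite.exists_max fun R : {R // F.IsConj Q R} =>
    Nat.card (Subgroup.normalizer (R.1 : Set P))
  exact ⟨R, hR, fun T hT => h ⟨T, hR.trans hT⟩⟩

theorem lt_normalizer {p : ℕ} [Fact p.Prime] [Finite P] (hP : IsPGroup p P) {Q : Subgroup P}
    (hQ : Q < ⊤) : Q < Subgroup.normalizer (Q : Set P) :=
  have := hP.isNilpotent
  Group.normalizerCondition_of_isNilpotent Q hQ

theorem IsSaturated.isReceptive {p : ℕ} (hF : F.IsSaturated p) {Q : Subgroup P}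
    (hQ : F.IsFullyNormalized Q) : F.IsReceptive Q := by
  intro R φ hφ hs
  let φ' : R →* (⊤ : Subgroup P) := (Subgroup.inclusion le_top).comp φ
  have h : ∀ x, (φ x : P) = φ' x := fun x => rfl
  refine Extends.congr h (hF.extend R φ' (F.mem_of_coe_eq' hφ _ fun x => (h x).symm) ?_)
  rwa [← image_congr h, image_eq_of_surjective hs]

theorem IsReceptive.exists_extension {Q R : Subgroup P} (hR : F.IsReceptive R) {e : Q ≃* R}
    (he : e.toMonoidHom ∈ F.Hom Q R) {N : Subgroup P}
    (hN : N ≤ extender e.toMonoidHom) :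
    ∃ χ ∈ F.Hom N ⊤, ∀ (u : Q) (n : N), (n : P) = u → (χ n : P) = e u := by
  obtain ⟨ψ, hψ, h⟩ := hR Q _ he e.surjective
  exact ⟨ψ.comp (Subgroup.inclusion hN), F.mem_of_coe_eq hψ hN _ fun _ => rfl,
    fun u n hn => h u _ hn⟩

theorem card_lt_card [Finite P] {Q R : Subgroup P} (h : Q < R) : Nat.card Q < Nat.card R :=
  lt_of_le_of_ne (Subgroup.card_le_of_le h.le) fun he =>
    h.ne (Subgroup.eq_of_le_of_card_ge h.le he.ge)

end Basic

end FusionSystem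

namespace FusionSystem

/-! ### Generation by automorphism groups. -/

section Generation

variable {P : Type u} [Group P] {E : FusionSystem P}

theorem IsReceptive.mem_of_lt_extender {R : Subgroup P} (hR : E.IsReceptive R)
    {D : FusionSystem P} {Q : Subgroup P} {ψ : Q →* R} (hψ : ψ ∈ E.Hom Q R)
    (hs : Function.Surjective ψ) (hlt : Q < extender ψ)
    (hD : E.Hom (extender ψ) ⊤ ⊆ D.Hom (extender ψ) ⊤) : ψ ∈ D.Hom Q R := by
  obtain ⟨χ, hχ, h⟩ := hR Q ψ hψ hs
  exact D.mem_of_coe_eq (hD hχ) hlt.le ψ fun x => (h x _ rfl).symm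

/-- Alperin's argument: if every proper subgroup has a reproductive conjugate, then the essential
members of a conjugacy representative, together with `P`, control the fusion system. -/
theorem IsConjRepresentative.hom_subset [Finite P] {U : Set (Subgroup P)}
    (hU : E.IsConjRepresentative {R | E.IsReproductive R} U)
    (hex : ∀ Q : Subgroup P, Q < ⊤ → ∃ R, E.IsConj Q R ∧ E.IsReproductive R)
    (D : FusionSystem P)
    (hD : ∀ T : Subgroup P, ((T ∈ U ∧ E.IsEssential T) ∨ T = ⊤) → E.Aut T ≤ D.Aut T)
    (Q : Subgroup P) : ∀ R, E.Hom Q R ⊆ D.Hom Q R := by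
  induction hn : Nat.card P - Nat.card Q using Nat.strong_induction_on generalizing Q with
  | _ n ih =>
  subst hn
  intro R φ hφ
  rcases eq_or_ne Q ⊤ with rfl | hQ
  · have ht : image φ = ⊤ := ((isConj_image hφ).top_iff).1 rfl
    obtain rfl : R = ⊤ := by
      rw [eq_top_iff, ← ht]
      intro x hx
      obtain ⟨u, rfl⟩ := mem_image.1 hx
      exact (φ u).2
    have hc : E.IsConj (⊤ : Subgroup P) ⊤ := .refl ⊤
    exact hD ⊤ (.inr rfl)
      (show MulEquiv.ofBijective φ ⟨E.injective hφ, hc.surjective hφ⟩ ∈ E.Aut ⊤ from hφ)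
  · obtain ⟨V, hQV, hV⟩ := hex Q (lt_top_iff_ne_top.2 hQ)
    obtain ⟨T, ⟨hTU, hVT⟩, -⟩ := hU.2 V hV
    have hT : E.IsReproductive T := hU.1 hTU
    -- The extension of `ψ` lives on a subgroup larger than `Q`, so the induction hypothesis covers
    -- it and `ψ` is its restriction.
    have hext : ∀ Q' : Subgroup P, E.IsConj T Q' → ∀ ψ ∈ E.Hom Q' T, Q' < extender ψ →
        ψ ∈ D.Hom Q' T := by
      intro Q' hQ' ψ hψ hlt
      refine hT.receptive.mem_of_lt_extender hψ (hQ'.symm.surjective hψ) hlt (ih _ ?_ _ rfl ⊤)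
      have h1 := card_lt_card hlt
      have h2 := Subgroup.card_le_card_group (extender ψ)
      have h3 := (hQV.trans (hVT.trans hQ')).card_eq
      omega
    have haut : E.Aut T ≤ D.Aut T := by
      by_cases hess : E.IsEssential T
      · exact hD T (.inl ⟨hTU, hess⟩)
      · have hle : E.essentialKernel T ≤ E.Aut T :=
          (Subgroup.closure_le _).2 fun α hα => hα.1
        have hge : E.Aut T ≤ E.essentialKernel T := by
          by_contra hn
          exact hess ⟨hT, lt_of_le_not_ge hle hn⟩
        refine hge.trans ((Subgroup.closure_le _).2 fun α hα => ?_)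
        exact hext T (.refl T) _ hα.1 hα.2
    have hiso : ∀ Q' : Subgroup P, E.IsConj T Q' → ∀ e : Q' ≃* T, e.toMonoidHom ∈ E.Hom Q' T →
        e.toMonoidHom ∈ D.Hom Q' T := by
      intro Q' hQ' e he
      obtain ⟨ψ, hψ, hlt⟩ := hT.exists_lt Q' hQ'
      let f : Q' ≃* T := MulEquiv.ofBijective ψ ⟨E.injective hψ, hQ'.symm.surjective hψ⟩
      have hf : f.toMonoidHom ∈ E.Hom Q' T := hψ
      have hf' : f.toMonoidHom ∈ D.Hom Q' T := hext Q' hQ' ψ hψ hlt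
      have ha : f.symm.trans e ∈ E.Aut T := E.comp_mem (E.symm_mem f hf) he
      have h := D.comp_mem hf' (haut ha)
      -- `e` is `f` followed by the automorphism `e ∘ f⁻¹` of `T`.
      convert h using 1
      ext x
      simp
    have hQT := hQV.trans hVT
    obtain ⟨e, he⟩ := E.isConj_iff.1 hQT
    obtain ⟨f, hf, hfφ⟩ := E.exists_equiv_image hφ
    -- `φ = g⁻¹ ∘ e` with `g = e ∘ f⁻¹`; both `e` and `g` are isomorphisms onto `T`.
    have hg : (f.symm.trans e).toMonoidHom ∈ E.Hom (image φ) T :=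
      E.comp_mem (E.symm_mem f hf) he
    have hg' := D.symm_mem _ (hiso _ (hQT.symm.trans (isConj_image hφ)) _ hg)
    refine D.mem_of_coe_eq' (D.comp_mem (hiso Q hQT.symm e he) hg') φ fun x => ?_
    simp [← hfφ]

end Generation

end FusionSystem

namespace FusionSystem

/-! ### The Sylow property at fully normalized subgroups. -/

section Sylow

theorem exists_mem_normalizer_of_lt_sylow {p : ℕ} [Fact p.Prime] {G : Type*} [Group G] [Finite G]
    {B : Subgroup G} {T : Sylow p G} (hBT : B < T) :
    ∃ g ∈ T, g ∉ B ∧ g ∈ Subgroup.normalizer (B : Set G) := by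
  have hn := T.2.isNilpotent
  have hlt : B.subgroupOf T < ⊤ := by
    rw [lt_top_iff_ne_top, ne_eq, Subgroup.subgroupOf_eq_top]
    exact not_le_of_gt hBT
  obtain ⟨g, hg, hgB⟩ := SetLike.exists_of_lt (Group.normalizerCondition_of_isNilpotent _ hlt)
  refine ⟨g, g.2, fun h => hgB (Subgroup.mem_subgroupOf.2 h), ?_⟩
  have key : ∀ t : T, (t ∈ Subgroup.normalizer (B.subgroupOf T : Set T)) → ∀ b ∈ B,
      (t : G) * b * (t : G)⁻¹ ∈ B := fun t ht b hb =>
    (Subgroup.mem_normalizer_iff.1 ht ⟨b, hBT.le hb⟩).1 hb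
  refine Subgroup.mem_normalizer_iff.2 fun b => ⟨key g hg b, fun hb => ?_⟩
  have := key g⁻¹ (inv_mem hg) _ hb
  simpa [mul_assoc] using this

theorem exists_isConj_mem_sylow {p : ℕ} [Fact p.Prime] {G : Type*} [Group G] [Finite G]
    (T : Sylow p G) {K : Subgroup G} (hK : IsPGroup p K) :
    ∃ a : G, ∀ k ∈ K, a * k * a⁻¹ ∈ T := by
  obtain ⟨T', hT'⟩ := hK.exists_le_sylow
  obtain ⟨a, rfl⟩ := MulAction.exists_smul_eq G T' T
  refine ⟨a, fun k hk => ?_⟩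
  change _ ∈ ((a • T' : Sylow p G) : Subgroup G)
  rw [Sylow.coe_subgroup_smul]
  exact Subgroup.smul_mem_pointwise_smul k (MulAut.conj a) _ (hT' hk)

variable {S : Type u} [Group S] {F : FusionSystem S}

theorem extender_of_normalizes {Q R : Subgroup S} (e : Q ≃* R)
    (h : ∀ a ∈ innerAut Q, (e.symm.trans a).trans e ∈ innerAut R) :
    Subgroup.normalizer (Q : Set S) ≤ extender e.toMonoidHom := by
  intro x hx
  obtain ⟨y, hy, hxy⟩ := mem_innerAut.1 (h (Q.normalizerMonoidHom ⟨x, hx⟩) ⟨⟨x, hx⟩, rfl⟩)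
  refine ⟨hx, y, ?_, fun u v huv => ?_⟩
  · rwa [image_eq_of_surjective e.surjective]
  · have hv : Q.normalizerMonoidHom ⟨x, hx⟩ u = v := Subtype.ext huv.symm
    have := hxy (e u)
    simpa [hv] using this

/-- If `χ` extends `e : Q ≃ R` to a subgroup normalizing `Q`, then its image normalizes `R`. -/
theorem image_normalizes {N Q R : Subgroup S} {χ : N →* (⊤ : Subgroup S)} {e : Q ≃* R}
    (hN : N ≤ Subgroup.normalizer (Q : Set S)) (hQN : Q ≤ N)
    (h : ∀ (u : Q) (n : N), (n : S) = u → (χ n : S) = e u) (x : N) :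
    (χ x : S) ∈ Subgroup.normalizer (R : Set S) := by
  have key : ∀ x : N, ∀ r ∈ R, (χ x : S) * r * (χ x : S)⁻¹ ∈ R := by
    intro x r hr
    obtain ⟨u, hu⟩ := e.surjective ⟨r, hr⟩
    have hw := (Subgroup.mem_normalizer_iff.1 (hN x.2) u).1 u.2
    have h1 := h u ⟨u, hQN u.2⟩ rfl
    have h2 := h ⟨_, hw⟩ (x * ⟨u, hQN u.2⟩ * x⁻¹) rfl
    rw [hu] at h1
    have h3 : (χ x : S) * r * (χ x : S)⁻¹ = e ⟨_, hw⟩ := by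
      rw [← h2]
      simp [h1]
    rw [h3]
    exact (e _).2
  refine Subgroup.mem_normalizer_iff.2 fun r => ⟨key x r, fun hr => ?_⟩
  simpa [mul_assoc] using key x⁻¹ _ hr

variable [Finite S]

/-- In a saturated fusion system, if `Aut_S(M)` is Sylow in `Aut_F(M)` for fully normalized `M`
with `|M| > |R|`, then a `p`-power order automorphism of `N_S(R)` restricting to `R` acts on `R` as
conjugation with an element of `S`, provided `R` is fully normalized. -/
theorem mem_innerAut_of_extends {p : ℕ} [Fact p.Prime] {R : Subgroup S}
    (hR : F.IsFullyNormalized R)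
    (hS : ∀ M : Subgroup S, Nat.card M = Nat.card (Subgroup.normalizer (R : Set S)) →
      F.IsFullyNormalized M →
      ∃ T : Sylow p (F.Aut M), (T : Subgroup (F.Aut M)) = (innerAut M).subgroupOf (F.Aut M))
    {ψ : MulAut (Subgroup.normalizer (R : Set S))} (hψ : ψ ∈ F.Aut _) {k : ℕ}
    (hk : ψ ^ p ^ k = 1)
    {φ : MulAut R} (h : ∀ (u : R) (n : Subgroup.normalizer (R : Set S)), (n : S) = u → (ψ n : S) = φ u) : φ ∈ innerAut R := by
  obtain ⟨M, hNM, hM⟩ := F.exists_isFullyNormalized (Subgroup.normalizer (R : Set S))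
  obtain ⟨T, hT⟩ := hS M hNM.card_eq.symm hM
  obtain ⟨τ, hτ⟩ := F.isConj_iff.1 hNM
  let β : F.Aut M := ⟨(τ.symm.trans ψ).trans τ, F.comp_mem (F.symm_mem τ hτ) (F.comp_mem hψ hτ)⟩
  have hpow : ∀ n : ℕ, ∀ x, (β ^ n : F.Aut M).1 x = τ ((ψ ^ n) (τ.symm x)) := by
    intro n
    induction n with
    | zero => simp
    | succ n ih =>
      intro x
      rw [pow_succ, pow_succ]
      change (β ^ n : F.Aut M).1 (β.1 x) = _
      rw [ih]
      simp [β]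
  have hβ : β ^ p ^ k = 1 := by
    apply Subtype.ext
    ext x
    rw [hpow, hk]
    simp
  have hK : IsPGroup p (Subgroup.zpowers β) := by
    rintro ⟨_, n, rfl⟩
    refine ⟨k, Subtype.ext ?_⟩
    change (β ^ n) ^ p ^ k = 1
    rw [← zpow_natCast, zpow_comm, zpow_natCast, hβ, one_zpow]
  obtain ⟨a, ha⟩ := exists_isConj_mem_sylow T hK
  have h1 : a * β * a⁻¹ ∈ (T : Subgroup (F.Aut M)) := ha β (Subgroup.mem_zpowers β)
  rw [hT, Subgroup.mem_subgroupOf, mem_innerAut] at h1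
  obtain ⟨y, -, hy⟩ := h1
  -- After twisting `τ` by `a`, the automorphism `ψ` corresponds to conjugation by `y` on `M`.
  let σ := τ.trans a.1
  have hσ : σ.toMonoidHom ∈ F.Hom _ M := F.comp_mem hτ a.2
  have hyσ : ∀ x, (σ (ψ x) : S) = y * σ x * y⁻¹ := by
    intro x
    rw [← hy (σ x)]
    simp [σ, β]
  let ρ : R →* M := σ.toMonoidHom.comp (Subgroup.inclusion Subgroup.le_normalizer)
  have hρ : ρ ∈ F.Hom R M := F.comp_mem (F.conj_mem 1 _ (by simp)) hσ
  obtain ⟨e, he, hee⟩ := F.exists_equiv_image hρ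
  have hMle : M ≤ Subgroup.normalizer (image ρ : Set S) := by
    intro m hm
    obtain ⟨n, hn⟩ := σ.surjective ⟨m, hm⟩
    have := image_normalizes (χ := (Subgroup.inclusion le_top).comp σ.toMonoidHom) (e := e) le_rfl
      Subgroup.le_normalizer (fun u n hn => ?_) n
    · simpa [hn] using this
    · obtain rfl : n = Subgroup.inclusion Subgroup.le_normalizer u := Subtype.ext hn
      rw [hee]
      rfl
  -- `M` normalizes the image of `R`, whose normalizer is no larger than `N_S(R)`, which has the
  -- order of `M`.
  have hMeq : M = Subgroup.normalizer (image ρ : Set S) :=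
    Subgroup.eq_of_le_of_card_ge hMle ((hR _ (isConj_image hρ)).trans hNM.card_eq.le)
  have hyM : y ∈ M := by
    have hyK : ∀ r ∈ image ρ, y * r * y⁻¹ ∈ image ρ := by
      intro r hr
      obtain ⟨u, rfl⟩ := mem_image.1 hr
      refine mem_image.2 ⟨φ u, ?_⟩
      change (σ _ : S) = y * σ _ * y⁻¹
      -- `ψ` preserves `R`, so `y` normalizes its image and hence lies in `M`; its preimage under
      -- `σ` is the conjugating element.
      rw [← hyσ]
      congr 2
      exact Subtype.ext (h u _ rfl).symm
    rw [hMeq]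
    exact Subgroup.mem_normalizer_fintype hyK
  obtain ⟨z, hz⟩ := σ.surjective ⟨y, hyM⟩
  refine mem_innerAut.2 ⟨z, z.2, fun x => ?_⟩
  have h2 : ψ (Subgroup.inclusion Subgroup.le_normalizer x) =
      z * (Subgroup.inclusion Subgroup.le_normalizer x) * z⁻¹ := by
    apply σ.injective
    apply Subtype.ext
    rw [hyσ]
    simp [hz]
  rw [← h x (Subgroup.inclusion Subgroup.le_normalizer x) rfl, h2]
  rfl

/-- Saturation gives the Sylow property only at `S`; it descends by induction. If `Aut_S(R)` were
not Sylow, a `p`-element `φ` outside it would normalize it, hence extend to `N_S(R)`, where the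
larger case forces `φ` to be conjugation by an element of `S`. -/
theorem IsSaturated.exists_sylow {p : ℕ} [Fact p.Prime] (hS : IsPGroup p S)
    (hF : F.IsSaturated p) (R : Subgroup S) : F.IsFullyNormalized R →
    ∃ T : Sylow p (F.Aut R), (T : Subgroup (F.Aut R)) = (innerAut R).subgroupOf (F.Aut R) := by
  induction hn : Nat.card S - Nat.card R using Nat.strong_induction_on generalizing R with
  | _ n ih =>
  subst hn
  intro hR
  rcases eq_or_ne R ⊤ with rfl | hRt
  · exact hF.sylow
  have hlt := lt_normalizer hS (lt_top_iff_ne_top.2 hRt)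
  have hB : IsPGroup p ((innerAut R).subgroupOf (F.Aut R)) := by
    have h0 : IsPGroup p (innerAut R) :=
      (hS.to_subgroup _).of_surjective _ (MonoidHom.rangeRestrict_surjective _)
    exact h0.comap_of_injective _ (F.Aut R).subtype_injective
  obtain ⟨T, hT⟩ := hB.exists_le_sylow
  refine ⟨T, ?_⟩
  by_contra hne
  obtain ⟨φ, hφT, hφB, hφn⟩ := exists_mem_normalizer_of_lt_sylow (lt_of_le_of_ne hT (Ne.symm hne))
  have hext : Subgroup.normalizer (R : Set S) ≤ extender φ.1.toMonoidHom := by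
    refine extender_of_normalizes φ.1 fun a ha => ?_
    have := (Subgroup.mem_normalizer_iff.1 hφn ⟨a, innerAut_le_aut R ha⟩).1 ha
    exact this
  obtain ⟨χ, hχ, hχφ⟩ := (hF.isReceptive hR).exists_extension φ.2 hext
  have hχn := image_normalizes le_rfl hlt.le hχφ
  let χ' : Subgroup.normalizer (R : Set S) →* Subgroup.normalizer (R : Set S) :=
    ((⊤ : Subgroup S).subtype.comp χ).codRestrict _ hχn
  have hχ' : χ' ∈ F.Hom _ _ := F.mem_of_coe_eq' hχ _ fun _ => rfl
  let ψ : MulAut (Subgroup.normalizer (R : Set S)) :=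
    MulEquiv.ofBijective χ' (Finite.injective_iff_bijective.1 (F.injective hχ'))
  have hψ : ψ ∈ F.Aut _ := hχ'
  have hψφ : ∀ (u : R) (n : Subgroup.normalizer (R : Set S)), (n : S) = u →
    (ψ n : S) = φ.1 u := hχφ
  have hpow : ∀ m : ℕ, ∀ (u : R) (n : Subgroup.normalizer (R : Set S)), (n : S) = u →
      ((ψ ^ m) n : S) = (φ.1 ^ m) u := by
    intro m
    induction m with
    | zero => exact fun _ _ h => h
    | succ m ih =>
      intro u n h
      rw [pow_succ, pow_succ]
      exact ih _ _ (hψφ u n h)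
  -- The extension `ψ` need not have `p`-power order, but `ψ ^ m` does; as `m` is prime to `p`, `φ`
  -- is recovered as a power of `φ ^ m`.
  obtain ⟨k, m, hm, hkm⟩ := Nat.exists_eq_pow_mul_and_not_dvd (orderOf_pos ψ).ne' p
    (Fact.out : p.Prime).ne_one
  have hmem : φ.1 ^ m ∈ innerAut R := by
    refine mem_innerAut_of_extends hR (fun M hM hMn => ih _ ?_ M rfl hMn)
      (ψ := ψ ^ m) (pow_mem hψ m) (k := k) ?_ (hpow m)
    · have h1 := card_lt_card hlt
      have h2 := Subgroup.card_le_card_group M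
      omega
    · rw [← pow_mul, mul_comm, ← hkm, pow_orderOf_eq_one]
  apply hφB
  obtain ⟨l, hl⟩ := T.2 ⟨φ, hφT⟩
  have hl' : φ ^ p ^ l = 1 := congrArg Subtype.val hl
  have hcop : Nat.Coprime (orderOf φ) m :=
    Nat.Coprime.coprime_dvd_left (orderOf_dvd_of_pow_eq_one hl')
      (Nat.Coprime.pow_left _ ((Nat.Prime.coprime_iff_not_dvd Fact.out).2 hm))
  obtain ⟨j, hj⟩ := exists_pow_eq_self_of_coprime hcop.symm
  rw [← hj]
  exact pow_mem (show φ ^ m ∈ (innerAut R).subgroupOf (F.Aut R) from hmem) j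

/-- Any isomorphism `f : Q → R` carries `Aut_S(Q)` to a `p`-subgroup of `Aut_F(R)`. Sylow's theorem
moves it into `Aut_S(R)` by some `a`, so `a ∘ f` has extender `N_S(Q)`, and receptivity extends it.
-/
theorem IsSaturated.exists_normalizer_extension {p : ℕ} [Fact p.Prime] (hS : IsPGroup p S)
    (hF : F.IsSaturated p) {Q R : Subgroup S} (hR : F.IsFullyNormalized R) (hRQ : F.IsConj R Q) :
    ∃ e : Q ≃* R, e.toMonoidHom ∈ F.Hom Q R ∧
      ∃ χ ∈ F.Hom (Subgroup.normalizer (Q : Set S)) ⊤,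
      ∀ (u : Q) (n : Subgroup.normalizer (Q : Set S)), (n : S) = u → (χ n : S) = e u := by
  obtain ⟨T, hT⟩ := hF.exists_sylow hS R hR
  obtain ⟨f, hf⟩ := F.isConj_iff.1 hRQ.symm
  let c : F.Aut Q →* F.Aut R :=
    (((MulAut.congr f).toMonoidHom.comp (F.Aut Q).subtype).codRestrict (F.Aut R) fun a =>
      F.comp_mem (F.symm_mem f hf) (F.comp_mem a.2 hf))
  have hK : IsPGroup p (((innerAut Q).subgroupOf (F.Aut Q)).map c) := by
    have h0 : IsPGroup p (innerAut Q) :=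
      (hS.to_subgroup _).of_surjective _ (MonoidHom.rangeRestrict_surjective _)
    exact (h0.comap_of_injective _ (F.Aut Q).subtype_injective).map c
  obtain ⟨a, ha⟩ := exists_isConj_mem_sylow T hK
  have he : (f.trans a.1).toMonoidHom ∈ F.Hom Q R := F.comp_mem hf a.2
  refine ⟨f.trans a.1, he, (hF.isReceptive hR).exists_extension he
    (extender_of_normalizes _ fun b hb => ?_)⟩
  have h1 : _ ∈ (T : Subgroup (F.Aut R)) := ha (c ⟨b, innerAut_le_aut Q hb⟩) ⟨_, hb, rfl⟩
  rw [hT] at h1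
  exact h1

end Sylow

end FusionSystem

namespace FusionSystem

/-! ### Descent from the saturated system to `P`. -/

section Semisaturated

variable {P : Type u} [Group P] {E : FusionSystem P} {S : Type u} [Group S] {F : FusionSystem S}
  {ι : P →* S}

theorem IsStronglyClosed.map_mem {K : Subgroup S} (hK : F.IsStronglyClosed K) {Q R : Subgroup S}
    {φ : Q →* R} (hφ : φ ∈ F.Hom Q R) (x : Q) (hx : (x : S) ∈ K) : (φ x : S) ∈ K := by
  have hle : Subgroup.zpowers (x : S) ≤ Q := by simp
  exact hK x hx _ (F.mem_of_coe_eq hφ hle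
    (((Subgroup.inclusion le_top).comp φ).comp (Subgroup.inclusion hle)) fun _ => rfl)

theorem coe_transport (hι : Function.Injective ι) {Q R : Subgroup P} (φ : Q →* R) (x : Q)
    (h : ι x ∈ Q.map ι) : (transport ι hι φ ⟨ι x, h⟩ : S) = ι (φ x) := by
  have : (Q.equivMapOfInjective ι hι).symm ⟨ι x, h⟩ = x := by
    rw [MulEquiv.symm_apply_eq]
    rfl
  simp [transport, this]

theorem transport_surjective (hι : Function.Injective ι) {Q R : Subgroup P} {φ : Q →* R}
    (hs : Function.Surjective φ) : Function.Surjective (transport ι hι φ) :=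
  (R.equivMapOfInjective ι hι).surjective.comp
    (hs.comp (Q.equivMapOfInjective ι hι).symm.surjective)

/-- `E` is the restriction of `F` to the subgroups of `P`, embedded via `ι`. -/
def IsRestriction (ι : P →* S) (hι : Function.Injective ι) (E : FusionSystem P)
    (F : FusionSystem S) : Prop :=
  ∀ (Q R : Subgroup P) (φ : Q →* R),
    φ ∈ E.Hom Q R ↔ transport ι hι φ ∈ F.Hom (Q.map ι) (R.map ι)

variable {hι : Function.Injective ι}

/-- The way back from `F` to `E`: an `F`-morphism is cut down to subgroups of `P` once its values
are known to lie in `P`. -/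
theorem IsRestriction.exists_mem (h : IsRestriction ι hι E F) {X Y : Subgroup P}
    {X' Y' : Subgroup S} {χ : X' →* Y'} (hχ : χ ∈ F.Hom X' Y') (hX : ∀ x ∈ X, ι x ∈ X')
    (hY : ∀ (x : X), ∃ y ∈ Y, ι y = χ ⟨ι x, hX x x.2⟩) :
    ∃ ψ ∈ E.Hom X Y, ∀ x : X, ι (ψ x) = χ ⟨ι x, hX x x.2⟩ := by
  choose f hf hfι using hY
  let ψ : X →* Y := MonoidHom.mk' (fun x => ⟨f x, hf x⟩) fun a b => by
    apply Subtype.ext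
    apply hι
    change ι (f (a * b)) = ι (f a * f b)
    rw [map_mul, hfι, hfι, hfι]
    have hab : (⟨ι (a * b : X), hX _ (a * b).2⟩ : X') = ⟨ι a, hX a a.2⟩ * ⟨ι b, hX b b.2⟩ :=
      Subtype.ext (map_mul ι _ _)
    exact (congrArg (fun z => (χ z : S)) hab).trans
      (congrArg Subtype.val (map_mul χ _ _))
  have hψ : ∀ x : X, ι (ψ x) = χ ⟨ι x, hX x x.2⟩ := hfι
  refine ⟨ψ, (h X Y ψ).2 (F.mem_of_coe_eq hχ ?_ _ ?_), hψ⟩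
  · rintro _ ⟨x, hx, rfl⟩
    exact hX x hx
  · rintro ⟨_, x, hx, rfl⟩
    exact (coe_transport hι ψ ⟨x, hx⟩ _).trans (hψ ⟨x, hx⟩)

theorem IsRestriction.isConj_map (h : IsRestriction ι hι E F) {Q R : Subgroup P}
    (hQR : E.IsConj Q R) : F.IsConj (Q.map ι) (R.map ι) := by
  obtain ⟨φ, hφ, hs⟩ := hQR
  exact ⟨_, (h _ _ φ).1 hφ, transport_surjective hι hs⟩

theorem map_mem_normalizer {Q : Subgroup P} {x : P} (hx : x ∈ Subgroup.normalizer (Q : Set P)) :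
    ι x ∈ Subgroup.normalizer (Q.map ι : Set S) :=
  Subgroup.le_normalizer_map ι ⟨x, hx, rfl⟩

theorem exists_map_eq_of_isConj (hK : F.IsStronglyClosed ι.range) {Q : Subgroup P}
    {R' : Subgroup S} (h : F.IsConj (Q.map ι) R') : ∃ R : Subgroup P, R.map ι = R' := by
  obtain ⟨φ, hφ, hs⟩ := h
  refine ⟨R'.comap ι, Subgroup.map_comap_eq_self fun r hr => ?_⟩
  obtain ⟨q, hq⟩ := hs ⟨r, hr⟩
  have := hK.map_mem hφ q (Subgroup.map_le_range ι Q q.2)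
  rwa [hq] at this

theorem IsRestriction.isConj_of_map (h : IsRestriction ι hι E F) {Q R : Subgroup P}
    (hQR : F.IsConj (Q.map ι) (R.map ι)) : E.IsConj Q R := by
  obtain ⟨φ, hφ, hs⟩ := hQR
  obtain ⟨ψ, hψ, hψφ⟩ := h.exists_mem (X := Q) (Y := R) hφ
    (fun x hx => Subgroup.mem_map_of_mem ι hx) fun x => (φ _).2
  refine ⟨ψ, hψ, fun r => ?_⟩
  obtain ⟨⟨_, q, hq, rfl⟩, hqr⟩ := hs ⟨ι r, Subgroup.mem_map_of_mem ι r.2⟩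
  refine ⟨⟨q, hq⟩, Subtype.ext (hι ?_)⟩
  rw [hψφ, hqr]

/-- `ι` carries the extender in `P` into the one in `S`, and strong closure sends the restricted
`F`-extension back into `P`. -/
theorem IsRestriction.isReceptive (h : IsRestriction ι hι E F)
    (hK : F.IsStronglyClosed ι.range) {R : Subgroup P} (hR : F.IsReceptive (R.map ι)) :
    E.IsReceptive R := by
  intro Q φ hφ hs
  have hφ' := (h _ _ φ).1 hφ
  have hs' : Function.Surjective (transport ι hι φ) := transport_surjective hι hs
  obtain ⟨χ, hχ, hχφ⟩ := hR _ _ hφ' hs'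
  have hle : ∀ x ∈ extender φ, ι x ∈ extender (transport ι hι φ) := by
    rintro x ⟨hx, y, hy, hxy⟩
    refine ⟨map_mem_normalizer hx, ι y, ?_, ?_⟩
    · rw [image_eq_of_surjective hs']
      rw [image_eq_of_surjective hs] at hy
      exact map_mem_normalizer hy
    · rintro ⟨_, u, hu, rfl⟩ ⟨_, v, hv, rfl⟩ huv
      have h1 := coe_transport hι φ ⟨u, hu⟩ ⟨u, hu, rfl⟩
      have h2 := coe_transport hι φ ⟨v, hv⟩ ⟨v, hv, rfl⟩
      rw [hxy ⟨u, hu⟩ ⟨v, hv⟩ (hι (by simpa using huv)), map_mul, map_mul, map_inv, ← h1] at h2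
      exact h2
  obtain ⟨ψ, hψ, hψχ⟩ := h.exists_mem (X := extender φ) (Y := ⊤) hχ hle fun x => by
    obtain ⟨y, hy⟩ := hK.map_mem hχ ⟨ι x, hle x x.2⟩ ⟨x, rfl⟩
    exact ⟨y, trivial, hy⟩
  refine ⟨ψ, hψ, fun u n hn => hι ?_⟩
  rw [hψχ, hχφ ⟨ι u, Subgroup.mem_map_of_mem ι u.2⟩ _ (congrArg ι hn), coe_transport hι φ u]

theorem IsRestriction.exists_normalizer_extension [Finite S] {p : ℕ} [Fact p.Prime]
    (hS : IsPGroup p S) (hF : F.IsSaturated p) (h : IsRestriction ι hι E F)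
    (hK : F.IsStronglyClosed ι.range) {Q R : Subgroup P} (hR : F.IsFullyNormalized (R.map ι))
    (hRQ : E.IsConj R Q) :
    ∃ e : Q ≃* R, e.toMonoidHom ∈ E.Hom Q R ∧
      ∃ χ ∈ E.Hom (Subgroup.normalizer (Q : Set P)) ⊤,
      ∀ (u : Q) (n : Subgroup.normalizer (Q : Set P)), (n : P) = u → (χ n : P) = e u := by
  obtain ⟨e', he', χ', hχ', hχe⟩ := hF.exists_normalizer_extension hS hR (h.isConj_map hRQ)
  obtain ⟨ψ, hψ, hψe⟩ := h.exists_mem (X := Q) (Y := R) he'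
    (fun x hx => Subgroup.mem_map_of_mem ι hx) fun x => (e' _).2
  obtain ⟨χ, hχ, hχχ⟩ := h.exists_mem (X := Subgroup.normalizer (Q : Set P)) (Y := ⊤) hχ'
    (fun x hx => map_mem_normalizer hx) fun x => by
      obtain ⟨y, hy⟩ := hK.map_mem hχ' ⟨ι x, map_mem_normalizer x.2⟩ ⟨x, rfl⟩
      exact ⟨y, trivial, hy⟩
  have hfin : Finite P := Finite.of_injective ι hι
  refine ⟨MulEquiv.ofBijective ψ ⟨E.injective hψ, hRQ.symm.surjective hψ⟩, hψ, χ, hχ,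
    fun u n hn => hι ?_⟩
  rw [hχχ]
  refine (hχe ⟨ι u, Subgroup.mem_map_of_mem ι u.2⟩ _ (congrArg ι hn)).trans ?_
  exact (hψe u).symm

/-- Full normalization in `F` compares normalizers in `S`, not in `P`. Here the injective `χ` embeds
`N_P(Q)` in `N_P(R)`. -/
theorem isFullyNormalized_of_normalizer_extension [Finite P] {R : Subgroup P}
    (h : ∀ Q, E.IsConj R Q → ∃ e : Q ≃* R, e.toMonoidHom ∈ E.Hom Q R ∧
      ∃ χ ∈ E.Hom (Subgroup.normalizer (Q : Set P)) ⊤,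
      ∀ (u : Q) (n : Subgroup.normalizer (Q : Set P)), (n : P) = u → (χ n : P) = e u) :
    E.IsFullyNormalized R := by
  intro Q hQ
  obtain ⟨e, -, χ, hχ, hχe⟩ := h Q hQ
  have hn := image_normalizes le_rfl Subgroup.le_normalizer hχe
  refine Nat.card_le_card_of_injective
    (fun x => (⟨χ x, hn x⟩ : Subgroup.normalizer (R : Set P))) fun x y hxy => ?_
  exact E.injective hχ (Subtype.ext (Subtype.mk.inj hxy))

theorem isReproductive_of_normalizer_extension [Finite P] {p : ℕ} [Fact p.Prime]
    (hP : IsPGroup p P) {R : Subgroup P} (hRt : R < ⊤) (hR : E.IsReceptive R)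
    (h : ∀ Q, E.IsConj R Q → ∃ e : Q ≃* R, e.toMonoidHom ∈ E.Hom Q R ∧
      ∃ χ ∈ E.Hom (Subgroup.normalizer (Q : Set P)) ⊤,
      ∀ (u : Q) (n : Subgroup.normalizer (Q : Set P)), (n : P) = u → (χ n : P) = e u) :
    E.IsReproductive R := by
  refine ⟨hRt, hR, fun Q hQ => ?_⟩
  obtain ⟨e, he, χ, hχ, hχe⟩ := h Q hQ
  have hQt : Q < ⊤ := by
    rw [lt_top_iff_ne_top] at hRt ⊢
    rwa [ne_eq, ← hQ.top_iff]
  -- Conjugation by `x` is carried to conjugation by `χ x`, so the extender contains all of `N_P(Q)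
  -- > Q`.
  refine ⟨_, he, (lt_normalizer hP hQt).trans_le fun x hx => ⟨hx, χ ⟨x, hx⟩, ?_, ?_⟩⟩
  · rw [image_eq_of_surjective e.surjective]
    exact image_normalizes le_rfl Subgroup.le_normalizer hχe _
  · intro u v huv
    change (e v : P) = _ * e u * _
    have hw : (⟨v, Subgroup.le_normalizer v.2⟩ : Subgroup.normalizer (Q : Set P)) =
      ⟨x, hx⟩ * ⟨u, Subgroup.le_normalizer u.2⟩ * ⟨x, hx⟩⁻¹ := Subtype.ext huv
    rw [← hχe v ⟨v, Subgroup.le_normalizer v.2⟩ rfl, ← hχe u ⟨u, Subgroup.le_normalizer u.2⟩ rfl,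
      hw, map_mul, map_mul, map_inv]
    rfl

theorem IsSemisaturated.exists_reproductive [Finite P] {p : ℕ} [Fact p.Prime] (hP : IsPGroup p P)
    (hE : E.IsSemisaturated p) {Q : Subgroup P} (hQ : Q < ⊤) :
    ∃ R, E.IsConj Q R ∧ E.IsReproductive R ∧ E.IsFullyNormalized R := by
  obtain ⟨S, _, _, hS, ι, hι, F, hF, hK, h⟩ := hE
  replace h : IsRestriction ι hι E F := h
  obtain ⟨R', hQR, hR⟩ := F.exists_isFullyNormalized (Q.map ι)
  obtain ⟨R, rfl⟩ := exists_map_eq_of_isConj hK hQR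
  have hQR' := h.isConj_of_map hQR
  have hRt : R < ⊤ := by
    rw [lt_top_iff_ne_top] at hQ ⊢
    rwa [ne_eq, ← hQR'.top_iff]
  have hext := fun T hT => h.exists_normalizer_extension hS hF hK (Q := T) hR hT
  exact ⟨R, hQR', isReproductive_of_normalizer_extension hP hRt
    (h.isReceptive hK (hF.isReceptive hR)) hext, isFullyNormalized_of_normalizer_extension hext⟩

theorem exists_isMainEssentialCollection
    (h : ∀ Q : Subgroup P, Q < ⊤ →
      ∃ R, E.IsConj Q R ∧ E.IsReproductive R ∧ E.IsFullyNormalized R) :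
    ∃ C : Set (Subgroup P), E.IsMainEssentialCollection C := by
  let s : Setoid (Subgroup P) := ⟨E.IsConj, .refl, .symm, .trans⟩
  have hex : ∀ c : Quotient s, ∃ R : Subgroup P, (∃ Q < ⊤, Quotient.mk s Q = c) →
      Quotient.mk s R = c ∧ E.IsReproductive R ∧ E.IsFullyNormalized R := by
    intro c
    by_cases hc : ∃ Q < ⊤, Quotient.mk s Q = c
    · obtain ⟨Q, hQ, rfl⟩ := hc
      obtain ⟨R, hQR, hR⟩ := h Q hQ
      exact ⟨R, fun _ => ⟨Quotient.sound hQR.symm, hR⟩⟩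
    -- Junk value for a class without proper members; `U` below never uses it.
    · exact ⟨⊥, fun h => (hc h).elim⟩
  choose r hr using hex
  let U : Set (Subgroup P) := {R | ∃ Q < ⊤, R = r (Quotient.mk s Q)}
  have hU : ∀ R ∈ U, E.IsReproductive R ∧ E.IsFullyNormalized R := by
    rintro _ ⟨Q, hQ, rfl⟩
    exact (hr _ ⟨Q, hQ, rfl⟩).2
  refine ⟨{Q | Q ∈ U ∧ E.IsEssential Q}, ⟨U, ⟨fun R hR => (hU R hR).1, fun Q hQ => ?_⟩, rfl⟩,
    fun Q hQ => (hU Q hQ.1).2⟩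
  refine ⟨r (Quotient.mk s Q), ⟨⟨Q, hQ.proper, rfl⟩, ?_⟩, ?_⟩
  · exact IsConj.symm (Quotient.exact (hr _ ⟨Q, hQ.proper, rfl⟩).1)
  · rintro _ ⟨⟨T, hT, rfl⟩, hQT⟩
    have h1 : Quotient.mk s Q = Quotient.mk s (r (Quotient.mk s T)) := Quotient.sound hQT
    rw [h1, (hr _ ⟨T, hT, rfl⟩).1]

end Semisaturated

end FusionSystem

theorem mainTheorem8 {p : ℕ} [Fact p.Prime] {P : Type u} [Group P] [Finite P]
    (hP : IsPGroup p P) (E : FusionSystem P) (hE : E.IsSemisaturated p) :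
    (∃ C : Set (Subgroup P), E.IsMainEssentialCollection C) ∧
      ∀ C : Set (Subgroup P), E.IsMainEssentialCollection C →
        E = E.autGenerated {Q | Q ∈ C ∨ Q = ⊤} := by
  have hex : ∀ Q : Subgroup P, Q < ⊤ →
      ∃ R, E.IsConj Q R ∧ E.IsReproductive R ∧ E.IsFullyNormalized R :=
    fun Q hQ => hE.exists_reproductive hP hQ
  refine ⟨FusionSystem.exists_isMainEssentialCollection hex, ?_⟩
  rintro _ ⟨⟨U, hU, rfl⟩, -⟩
  refine FusionSystem.ext ?_
  funext Q R
  -- `E` is itself one of the systems being intersected, which gives one inclusion.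
  refine Set.Subset.antisymm (fun φ hφ D hD => ?_) fun φ hφ => hφ E fun _ _ => le_rfl
  exact hU.hom_subset (fun Q hQ => (hex Q hQ).imp fun R h => ⟨h.1, h.2.1⟩) D hD Q R hφ
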